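/- For every even integer $d\ge 2$ there is a positive integer $\mathbf{n}=\mathbf{n}(d)$, depending only on $d$, such that the following holds. Let $K$ be a field of characteristic $0$ that contains all roots of unity, let $V$ be a $d$-dimensional $K$-vector space, and let $\phi: V\times V\to K$ be a nondegenerate symmetric $K$-bilinear form that is anisotropic, i.e. $\phi(v,v)\neq 0$ for all nonzero $v\in V$. Let $\mathrm{GO}(V,\phi)$ be the group of similitudes of $\phi$, i.e. of the $K$-linear automorphisms $u$ of $V$ for which there is $\mu\in K^{*}$ with $\phi(ux,uy)=\mu\,\phi(x,y)$ for all $x,y\in V$, and let $\mathrm{PO}(V,\phi)=\mathrm{GO}(V,\phi)/(K^{*}\cdot 1_V)$. Then the group $\mathrm{PO}(V,\phi)$ is bounded, i.e. there is a positive integer $C$ such that every finite subgroup of $\mathrm{PO}(V,\phi)$ has order at most $C$; more precisely, the order of every finite subgroup of $\mathrm{PO}(V,\phi)$ divides $2^{\mathbf{n}(d)}$. -/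

import Mathlib

/-- The field `K` contains all roots of unity: for every `m ≥ 1` it contains a primitive
`m`-th root of unity (in characteristic zero, a generator of all `m`-th roots of unity of an
algebraic closure). -/
def ContainsAllRootsOfUnity (K : Type*) [Field K] : Prop :=
  ∀ m : ℕ, 0 < m → ∃ ζ : K, IsPrimitiveRoot ζ m

/-- A bilinear form is anisotropic if `φ(v, v) ≠ 0` for all nonzero `v`. -/
def BilinAnisotropic {K V : Type*} [Field K] [AddCommGroup V] [Module K V]
    (φ : LinearMap.BilinForm K V) : Prop :=
  ∀ v : V, v ≠ 0 → φ v v ≠ 0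

/-- The group `GO(V, φ)` of similitudes of `φ`. -/
def similitudeGroup {K V : Type*} [Field K] [AddCommGroup V] [Module K V]
    (φ : LinearMap.BilinForm K V) : Subgroup (V ≃ₗ[K] V) where
  carrier := {u | ∃ μ : Kˣ, ∀ x y : V, φ (u x) (u y) = (μ : K) * φ x y}
  one_mem' := ⟨1, fun x y => by simp⟩
  mul_mem' := by
    rintro a b ⟨μ, hμ⟩ ⟨ν, hν⟩
    exact ⟨μ * ν, fun x y => by
      rw [LinearEquiv.mul_apply, LinearEquiv.mul_apply, hμ, hν, Units.val_mul, mul_assoc]⟩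
  inv_mem' := by
    rintro a ⟨μ, hμ⟩
    refine ⟨μ⁻¹, fun x y => ?_⟩
    have h := hμ (a⁻¹ x) (a⁻¹ y)
    have h1 : ∀ z, a (a⁻¹ z) = z := fun z => a.apply_symm_apply z
    rw [h1, h1] at h
    rw [h, Units.inv_mul_cancel_left]

/-- The group `K^* · 1_V` of nonzero scalars, as a subgroup of `GO(V, φ)`. -/
def scalarSubgroup {K V : Type*} [Field K] [AddCommGroup V] [Module K V]
    (φ : LinearMap.BilinForm K V) : Subgroup (similitudeGroup φ) where
  carrier := {u | ∃ c : Kˣ, ∀ x : V, (u : V ≃ₗ[K] V) x = (c : K) • x}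
  one_mem' := ⟨1, fun x => by simp⟩
  mul_mem' := by
    rintro a b ⟨c, hc⟩ ⟨e, he⟩
    exact ⟨c * e, fun x => by
      rw [Subgroup.coe_mul, LinearEquiv.mul_apply, hc, he, Units.val_mul, mul_smul]⟩
  inv_mem' := by
    rintro a ⟨c, hc⟩
    refine ⟨c⁻¹, fun x => ?_⟩
    have h1 : (a : V ≃ₗ[K] V) (((a⁻¹ : similitudeGroup φ) : V ≃ₗ[K] V) x) = x :=
      (a : V ≃ₗ[K] V).apply_symm_apply x
    rw [hc] at h1
    rw [← h1, smul_smul, Units.inv_mul, one_smul, h1]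

instance scalarSubgroup_normal {K V : Type*} [Field K] [AddCommGroup V] [Module K V]
    (φ : LinearMap.BilinForm K V) : (scalarSubgroup φ).Normal where
  conj_mem := by
    rintro a ⟨c, hc⟩ g
    refine ⟨c, fun x => ?_⟩
    have h1 : (g : V ≃ₗ[K] V) (((g⁻¹ : similitudeGroup φ) : V ≃ₗ[K] V) x) = x :=
      (g : V ≃ₗ[K] V).apply_symm_apply x
    rw [Subgroup.coe_mul, Subgroup.coe_mul, LinearEquiv.mul_apply, LinearEquiv.mul_apply, hc,
      map_smul, h1]

/-- `PO(V, φ) = GO(V, φ) / (K^* · 1_V)`. -/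
abbrev ProjSimilitudeGroup {K V : Type*} [Field K] [AddCommGroup V] [Module K V]
    (φ : LinearMap.BilinForm K V) : Type _ :=
  similitudeGroup φ ⧸ scalarSubgroup φ

/-- A group is bounded if the orders of its finite subgroups are bounded by a positive integer. -/
def IsBoundedGroup (G : Type*) [Group G] : Prop :=
  ∃ C : ℕ, 0 < C ∧ ∀ H : Subgroup G, Finite H → Nat.card H ≤ C

/-! Let `u` be a similitude with multiplier `μ` and finite order modulo scalars. Then `μ⁻¹u²` is an
isometry of finite order; its eigenvalues are roots of unity, hence in `K`, and anisotropy forces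
them to be `±1`. So `u⁴ = μ²`, and every finite subgroup of `PO` is a 2-group of exponent dividing
4. Conjugation embeds it into the linear group of `End V`, where its elements are killed by `X⁴ - 1`
and so have only finitely many possible traces, their number bounded in terms of `d`. Burnside's
trace argument then bounds its order. -/

open Module in
/-- A finite order endomorphism, all of whose powers have the trace of the identity, is the
identity. -/
theorem Module.End.eq_one_of_trace_pow {K W : Type*} [Field K] [CharZero K] [AddCommGroup W]
    [Module K W] [FiniteDimensional K W] {w : End K W} {m : ℕ} (hm : 0 < m) (hw : w ^ m = 1)
    (ht : ∀ k : ℕ, LinearMap.trace K W (w ^ k) = finrank K W) : w = 1 := by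
  have hm0 : (m : K) ≠ 0 := by exact_mod_cast hm.ne'
  -- `P` projects onto the fixed space of `w`; its trace is the full dimension, so the idempotent `1
  -- - P` has trace `0`.
  set P : End K W := (m : K)⁻¹ • ∑ k ∈ Finset.range m, w ^ k with hP
  have hwP : w * P = P := by
    have h : w * ∑ k ∈ Finset.range m, w ^ k = ∑ k ∈ Finset.range m, w ^ k := by
      rw [Finset.mul_sum]
      simp_rw [← pow_succ']
      have h1 := Finset.sum_range_succ (fun k => w ^ k) m
      rw [Finset.sum_range_succ', hw, pow_zero] at h1
      exact add_right_cancel h1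
    rw [hP, mul_smul_comm, h]
  have hkP : ∀ k : ℕ, w ^ k * P = P := fun k => by
    induction k with
    | zero => simp
    | succ k ih => rw [pow_succ, mul_assoc, hwP, ih]
  have hPP : IsIdempotentElem P := by
    change P * P = P
    conv_lhs => rw [hP]
    rw [smul_mul_assoc, Finset.sum_mul]
    simp_rw [← hP, hkP]
    rw [Finset.sum_const, Finset.card_range, ← Nat.cast_smul_eq_nsmul K, smul_smul,
      inv_mul_cancel₀ hm0, one_smul]
  have htr : LinearMap.trace K W (1 - P) = 0 := by
    rw [map_sub, LinearMap.trace_one, hP, map_smul, map_sum]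
    simp_rw [ht]
    rw [Finset.sum_const, Finset.card_range, ← Nat.cast_smul_eq_nsmul K, smul_smul,
      inv_mul_cancel₀ hm0, one_smul, sub_self]
  have h1 : 1 - P = 0 := LinearMap.IsIdempotentElem.eq_zero_of_trace_eq_zero hPP.one_sub htr
  rw [sub_eq_zero] at h1
  rw [← h1, mul_one] at hwP
  exact hwP

open Module in
/-- Burnside's bound: a finite linear group in characteristic zero whose traces lie in a finite
set has bounded order. -/
theorem Nat.card_le_of_trace_mem {K W G : Type*} [Field K] [CharZero K] [AddCommGroup W]
    [Module K W] [FiniteDimensional K W] [Group G] [Finite G] (ρ : G →* End K W)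
    (hρ : Function.Injective ρ) (T : Finset K) (hT : ∀ g, LinearMap.trace K W (ρ g) ∈ T) :
    Nat.card G ≤ T.card ^ (finrank K W ^ 2) := by
  classical
  obtain ⟨κ, a, -, hsp, hli⟩ := exists_linearIndependent' K (fun g : G => ρ g)
  have : Fintype κ := @Fintype.ofFinite κ hli.finite
  have hκ : Fintype.card κ ≤ finrank K W ^ 2 := by
    rw [sq, ← finrank_linearMap K K W W]
    exact hli.fintype_card_le_finrank
  -- The `ρ (a i)` form a basis of the span of `ρ G`; the traces against it determine `g`.
  let F : G → κ → T := fun g i => ⟨LinearMap.trace K W (ρ (g * a i)), hT _⟩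
  have hF : Function.Injective F := by
    intro g h hgh
    have key : ∀ x ∈ Submodule.span K (Set.range fun g : G => ρ g),
        LinearMap.trace K W (ρ g * x) = LinearMap.trace K W (ρ h * x) := by
      rw [← hsp]
      intro x hx
      induction hx using Submodule.span_induction with
      | mem x hx =>
        obtain ⟨i, rfl⟩ := hx
        have := congrArg Subtype.val (congrFun hgh i)
        simpa [F, map_mul] using this
      | zero => simp
      | add x y _ _ hx hy => rw [mul_add, mul_add, map_add, map_add, hx, hy]
      | smul c x _ hx => rw [mul_smul_comm, mul_smul_comm, map_smul, map_smul, hx]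
    have key' : ∀ x : G, LinearMap.trace K W (ρ (g * x)) = LinearMap.trace K W (ρ (h * x)) :=
      fun x => by
        rw [map_mul ρ, map_mul ρ]
        exact key _ (Submodule.subset_span ⟨x, rfl⟩)
    have hpow : ∀ k : ℕ, LinearMap.trace K W (ρ (g * h⁻¹) ^ k) = finrank K W := fun k => by
      induction k with
      | zero => rw [pow_zero, LinearMap.trace_one]
      | succ k ih =>
        rw [← map_pow] at ih ⊢
        -- Replacing the leading `g` by `h` cancels one factor `g * h⁻¹`.
        rw [_root_.pow_succ', mul_assoc, key', mul_inv_cancel_left, ih]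
    have h1 := Module.End.eq_one_of_trace_pow (orderOf_pos (g * h⁻¹))
      (by rw [← map_pow, pow_orderOf_eq_one, map_one]) hpow
    exact mul_inv_eq_one.mp (hρ (h1.trans (map_one ρ).symm))
  rcases Nat.eq_zero_or_pos T.card with h0 | hpos
  · rw [Finset.card_eq_zero] at h0
    simpa [h0] using hT 1
  calc Nat.card G ≤ Nat.card (κ → T) := Nat.card_le_card_of_injective F hF
    _ = T.card ^ Fintype.card κ := by simp [Nat.card_eq_fintype_card]
    _ ≤ _ := Nat.pow_le_pow_right hpos hκ

open Module in
/-- The traces of the endomorphisms killed by `X ^ 4 - 1` lie in an explicit finite set. -/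
theorem exists_finset_trace_mem_of_pow_four_eq_one (K W : Type*) [Field K] [CharZero K]
    [AddCommGroup W] [Module K W] [FiniteDimensional K W] {i : K} (hi : i ^ 2 = -1) :
    ∃ T : Finset K, T.card ≤ (finrank K W + 1) ^ 4 ∧
      ∀ A : End K W, A ^ 4 = 1 → LinearMap.trace K W A ∈ T := by
  classical
  -- `f j` is the multiplicity of the eigenvalue `i ^ j`.
  refine ⟨(Finset.univ : Finset (Fin 4 → Fin (finrank K W + 1))).image
    (fun f => ∑ j : Fin 4, ((f j : ℕ) : K) * i ^ (j : ℕ)), ?_, fun A hA => ?_⟩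
  · refine Finset.card_image_le.trans ?_
    simp
  -- The operator is the projection onto the `c⁻¹`-eigenspace of `A`, so its trace is a rank.
  have proj : ∀ c : K, c ^ 4 = 1 → ∃ r : Fin (finrank K W + 1),
      LinearMap.trace K W ((4 : K)⁻¹ • (1 + c • A + c ^ 2 • A ^ 2 + c ^ 3 • A ^ 3)) = (r : ℕ) := by
    intro c hc
    set P : End K W := (4 : K)⁻¹ • (1 + c • A + c ^ 2 • A ^ 2 + c ^ 3 • A ^ 3) with hP
    have hB : (c • A) ^ 4 = 1 := by rw [smul_pow, hc, hA, one_smul]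
    have hP' : P = (4 : K)⁻¹ • (1 + c • A + (c • A) ^ 2 + (c • A) ^ 3) := by
      rw [hP, smul_pow, smul_pow]
    have hBP : (c • A) * P = P := by
      rw [hP', mul_smul_comm]
      congr 1
      calc (c • A) * (1 + c • A + (c • A) ^ 2 + (c • A) ^ 3)
          = c • A + (c • A) ^ 2 + (c • A) ^ 3 + (c • A) ^ 4 := by noncomm_ring
        _ = _ := by rw [hB]; abel
    have hPP : IsIdempotentElem P := by
      change P * P = P
      conv_lhs => arg 1; rw [hP']
      rw [smul_mul_assoc, add_mul, add_mul, add_mul, pow_succ _ 2, pow_two, mul_assoc, mul_assoc,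
        mul_assoc, hBP, hBP, hBP, one_mul, inv_smul_eq_iff₀ (by norm_num)]
      rw [show (4 : K) = 1 + 1 + 1 + 1 by norm_num, add_smul, add_smul, add_smul, one_smul]
    exact ⟨⟨_, Nat.lt_succ_of_le (Submodule.finrank_le P.range)⟩,
      (LinearMap.IsIdempotentElem.isProj_range P hPP).trace⟩
  have hi3 : i ^ 3 = -i := by rw [pow_succ, hi]; ring
  have hi4 : i ^ 4 = 1 := by rw [show i ^ 4 = (i ^ 2) ^ 2 by ring, hi]; ring
  obtain ⟨r0, h0⟩ := proj 1 (by norm_num)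
  obtain ⟨r1, h1⟩ := proj (i ^ 3) (by rw [← pow_mul, mul_comm, pow_mul, hi4, one_pow])
  obtain ⟨r2, h2⟩ := proj (i ^ 2) (by rw [hi]; norm_num)
  obtain ⟨r3, h3⟩ := proj i hi4
  refine Finset.mem_image.mpr ⟨![r0, r1, r2, r3], Finset.mem_univ _, ?_⟩
  simp only [Fin.sum_univ_four, Matrix.cons_val]
  change ((r0 : ℕ) : K) * i ^ 0 + ((r1 : ℕ) : K) * i ^ 1 + ((r2 : ℕ) : K) * i ^ 2 +
    ((r3 : ℕ) : K) * i ^ 3 = _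
  rw [← h0, ← h1, ← h2, ← h3]
  simp only [map_smul, map_add, smul_eq_mul, LinearMap.trace_one, hi3, hi]
  field_simp
  ring_nf
  rw [hi3, hi]
  ring_nf
  rw [hi4]
  ring

/-- A finite order isometry of an anisotropic form over a field with all roots of unity is an
involution. -/
theorem isometry_sq_eq_one {K V : Type*} [Field K] [CharZero K] [AddCommGroup V]
    [Module K V] {φ : LinearMap.BilinForm K V} (hK : ContainsAllRootsOfUnity K)
    (hφ : BilinAnisotropic φ)
    {v : Module.End K V} (hv : ∀ x y, φ (v x) (v y) = φ x y) {m : ℕ} (hm : 0 < m)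
    (hvm : v ^ m = 1) : v ^ 2 = 1 := by
  classical
  obtain ⟨ζ, hζ⟩ := hK m hm
  have inj : ∀ c : K, c ^ 2 ≠ 1 → ∀ x : V, v x = c • x → x = 0 := by
    intro c hc x hx
    by_contra hx0
    have h := hv x x
    rw [hx] at h
    simp only [map_smul, LinearMap.smul_apply, smul_eq_mul] at h
    apply hc
    apply mul_right_cancel₀ (hφ x hx0)
    linear_combination h
  -- The factors of `X ^ m - 1` at roots with `c ^ 2 ≠ 1` act injectively and can be cancelled; the
  -- remaining ones divide `X ^ 2 - 1`.
  have inj' : ∀ s : Finset K, (∀ c ∈ s, c ^ 2 ≠ 1) → ∀ x : V,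
      Polynomial.aeval v (∏ c ∈ s, (Polynomial.X - Polynomial.C c)) x = 0 → x = 0 := by
    intro s
    induction s using Finset.induction_on with
    | empty => intro _ x hx; simpa using hx
    | insert c s hc ih =>
      intro hs x hx
      rw [Finset.prod_insert hc, map_mul, Module.End.mul_apply] at hx
      refine ih (fun b hb => hs b (Finset.mem_insert_of_mem hb)) x
        (inj c (hs c (Finset.mem_insert_self c s)) _ ?_)
      rw [← sub_eq_zero]
      simpa using hx
  set s := Polynomial.nthRootsFinset m (1 : K)
  have hs : ∏ c ∈ s.filter (fun c => c ^ 2 = 1), (Polynomial.X - Polynomial.C c) ∣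
      (Polynomial.X ^ 2 - 1 : Polynomial K) := by
    have h2 : (Polynomial.X ^ 2 - 1 : Polynomial K) =
        ∏ c ∈ ({1, -1} : Finset K), (Polynomial.X - Polynomial.C c) := by
      rw [Finset.prod_pair (by norm_num [eq_neg_iff_add_eq_zero])]
      simp only [map_neg, map_one]
      ring
    rw [h2]
    refine Finset.prod_dvd_prod_of_subset _ _ _ fun c hc => ?_
    simpa using (Finset.mem_filter.mp hc).2
  obtain ⟨q, hq⟩ := hs
  ext x
  have h := Polynomial.X_pow_sub_one_eq_prod hm hζ
  rw [← Finset.prod_filter_not_mul_prod_filter s (fun c => c ^ 2 = 1)] at h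
  have hx : Polynomial.aeval v (∏ c ∈ s.filter (fun c => c ^ 2 = 1),
      (Polynomial.X - Polynomial.C c)) x = 0 := by
    refine inj' (s.filter fun c => ¬ c ^ 2 = 1) (fun c hc => (Finset.mem_filter.mp hc).2) _ ?_
    rw [← Module.End.mul_apply, ← map_mul, ← h]
    simp [hvm]
  have h3 := congrArg (fun p => Polynomial.aeval v p x) hq
  simp only [mul_comm _ q, map_mul, Module.End.mul_apply, hx] at h3
  simpa [sub_eq_zero] using h3

/-- In the group of projective similitudes of an anisotropic form over a field with all roots of
unity, the elements of finite order have order dividing four. -/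
theorem ProjSimilitudeGroup.pow_four_eq_one {K V : Type*} [Field K] [CharZero K] [AddCommGroup V]
    [Module K V] [Nontrivial V] {φ : LinearMap.BilinForm K V} (hK : ContainsAllRootsOfUnity K)
    (hφ : BilinAnisotropic φ) (g : ProjSimilitudeGroup φ) (hg : IsOfFinOrder g) :
    g ^ 4 = 1 := by
  obtain ⟨m, hm, hgm⟩ := isOfFinOrder_iff_pow_eq_one.mp hg
  induction g using QuotientGroup.induction_on with
  | H u =>
  obtain ⟨μ, hμ⟩ := u.2
  set A : Module.End K V := (u : V ≃ₗ[K] V).toLinearMap with hA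
  have hApow : ∀ (k : ℕ) (x : V), (A ^ k) x = ((u ^ k : similitudeGroup φ) : V ≃ₗ[K] V) x := by
    intro k
    induction k with
    | zero => intro x; simp
    | succ k ih =>
      intro x
      rw [pow_succ, pow_succ, Module.End.mul_apply, ih]
      rfl
  have hAμ : ∀ x y, φ (A x) (A y) = (μ : K) * φ x y := hμ
  rw [← QuotientGroup.mk_pow, QuotientGroup.eq_one_iff] at hgm ⊢
  obtain ⟨c, hc⟩ := hgm
  have hAm : A ^ m = (c : K) • 1 := by
    ext x
    rw [hApow, hc]
    rfl
  have hAφ : ∀ (k : ℕ) (x y : V), φ ((A ^ k) x) ((A ^ k) y) = (μ : K) ^ k * φ x y := by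
    intro k
    induction k with
    | zero => intro x y; simp
    | succ k ih =>
      intro x y
      rw [pow_succ, Module.End.mul_apply, Module.End.mul_apply, ih, hAμ]
      ring
  -- Comparing multipliers in `A ^ m = c` gives exactly `(μ⁻¹A²)^m = 1`.
  have hcμ : (c : K) ^ 2 = (μ : K) ^ m := by
    obtain ⟨x, hx⟩ := exists_ne (0 : V)
    have h := hAφ m x x
    rw [hAm] at h
    simp only [LinearMap.smul_apply, Module.End.one_apply, map_smul, smul_eq_mul] at h
    apply mul_right_cancel₀ (hφ x hx)
    linear_combination h
  have hμ0 : (μ : K) ≠ 0 := μ.ne_zero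
  have hv := isometry_sq_eq_one (v := (μ : K)⁻¹ • A ^ 2) hK hφ (fun x y => by
    simp only [LinearMap.smul_apply, map_smul, smul_eq_mul, hAφ]
    field_simp) hm (by
    rw [smul_pow, ← pow_mul, mul_comm 2, pow_mul, hAm, smul_pow, one_pow, smul_smul, hcμ,
      inv_pow, inv_mul_cancel₀ (pow_ne_zero _ hμ0), one_smul])
  rw [smul_pow, ← pow_mul, inv_pow, inv_smul_eq_iff₀ (pow_ne_zero _ hμ0)] at hv
  refine ⟨μ ^ 2, fun x => ?_⟩
  rw [← hApow, hv]
  simp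

/-- The action of a group of similitudes on endomorphisms by conjugation. -/
def similitudeConj {K V : Type*} [Field K] [AddCommGroup V] [Module K V]
    (φ : LinearMap.BilinForm K V) :
    similitudeGroup φ →* Module.End K (Module.End K V) where
  toFun u := ((u : V ≃ₗ[K] V).conj : Module.End K V →ₗ[K] Module.End K V)
  map_one' := rfl
  map_mul' _ _ := rfl

/-- The conjugation action of the projective similitude group. -/
def projSimilitudeConj {K V : Type*} [Field K] [AddCommGroup V] [Module K V]
    (φ : LinearMap.BilinForm K V) :
    ProjSimilitudeGroup φ →* Module.End K (Module.End K V) :=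
  QuotientGroup.lift (scalarSubgroup φ) (similitudeConj φ) (by
    rintro u ⟨c, hc⟩
    ext f x
    have h := hc ((u : V ≃ₗ[K] V).symm x)
    rw [LinearEquiv.apply_symm_apply] at h
    change (u : V ≃ₗ[K] V) (f ((u : V ≃ₗ[K] V).symm x)) = f x
    rw [hc, ← map_smul, ← h])

/-- An automorphism acting trivially by conjugation is central in `End V`, hence scalar. -/
theorem projSimilitudeConj_injective {K V : Type*} [Field K] [AddCommGroup V] [Module K V]
    [Nontrivial V] (φ : LinearMap.BilinForm K V) :
    Function.Injective (projSimilitudeConj φ) := by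
  rw [injective_iff_map_eq_one]
  intro g hg
  induction g using QuotientGroup.induction_on with
  | H u =>
  have hcomm : ∀ f : Module.End K V, ∀ x,
      (u : V ≃ₗ[K] V) (f x) = f ((u : V ≃ₗ[K] V) x) := by
    intro f x
    have h := LinearMap.congr_fun (LinearMap.congr_fun hg f) ((u : V ≃ₗ[K] V) x)
    change (u : V ≃ₗ[K] V) (f ((u : V ≃ₗ[K] V).symm ((u : V ≃ₗ[K] V) x))) = _ at h
    rwa [LinearEquiv.symm_apply_apply] at h
  have hz : (u : V ≃ₗ[K] V).toLinearMap ∈ Subalgebra.center K (Module.End K V) := by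
    rw [Subalgebra.mem_center_iff]
    intro f
    ext x
    exact (hcomm f x).symm
  rw [Algebra.IsCentral.center_eq_bot, Algebra.mem_bot] at hz
  obtain ⟨c, hc⟩ := hz
  have hc' : ∀ x, (u : V ≃ₗ[K] V) x = c • x := fun x => (LinearMap.congr_fun hc x).symm
  have hc0 : c ≠ 0 := by
    rintro rfl
    obtain ⟨x, hx⟩ := exists_ne (0 : V)
    have h := hc' x
    rw [zero_smul] at h
    exact hx ((LinearEquiv.map_eq_zero_iff _).mp h)
  exact (QuotientGroup.eq_one_iff u).mpr ⟨Units.mk0 c hc0, hc'⟩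

theorem mainTheorem10 (d : ℕ) (hd : 2 ≤ d) (hd_even : Even d) :
    ∃ n : ℕ, 0 < n ∧
      ∀ (K : Type*) [Field K] [CharZero K] (V : Type*) [AddCommGroup V] [Module K V]
        (φ : LinearMap.BilinForm K V),
        ContainsAllRootsOfUnity K → Module.finrank K V = d →
        φ.IsSymm → φ.Nondegenerate → BilinAnisotropic φ →
        IsBoundedGroup (ProjSimilitudeGroup φ) ∧
          ∀ H : Subgroup (ProjSimilitudeGroup φ), Finite H → Nat.card H ∣ 2 ^ n := by
  -- Burnside's bound `|T| ^ (dim (End V) ^ 2)` on the order `2 ^ k` serves as the exponent, since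
  -- `k ≤ 2 ^ k`.
  refine ⟨((d * d + 1) ^ 4) ^ ((d * d) ^ 2), by positivity, ?_⟩
  intro K _ _ V _ _ φ hK hdim _ _ hφ
  have : FiniteDimensional K V := FiniteDimensional.of_finrank_pos (by omega)
  have : Nontrivial V := Module.nontrivial_of_finrank_pos (R := K) (by omega)
  obtain ⟨i, hi⟩ := hK 4 (by norm_num)
  have hi2 : i ^ 2 = -1 :=
    (hi.pow (by norm_num) (show 4 = 2 * 2 by norm_num)).eq_neg_one_of_two_right
  obtain ⟨T, hTcard, hT⟩ :=
    exists_finset_trace_mem_of_pow_four_eq_one K (Module.End K V) hi2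
  have hEnd : Module.finrank K (Module.End K V) = d * d := by
    rw [← hdim]
    exact Module.finrank_linearMap K K V V
  rw [hEnd] at hTcard
  have main : ∀ H : Subgroup (ProjSimilitudeGroup φ), Finite H →
      Nat.card H ∣ 2 ^ ((d * d + 1) ^ 4) ^ ((d * d) ^ 2) := by
    intro H _
    have h4 : ∀ h : H, h ^ 4 = 1 := fun h => Subtype.ext (by
      simpa using ProjSimilitudeGroup.pow_four_eq_one hK hφ (h : ProjSimilitudeGroup φ)
        (H.subtype.isOfFinOrder (isOfFinOrder_of_finite h)))
    have hp : IsPGroup 2 H := fun h => ⟨2, h4 h⟩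
    obtain ⟨k, hk⟩ := IsPGroup.iff_card.mp hp
    have hle := Nat.card_le_of_trace_mem ((projSimilitudeConj φ).comp H.subtype)
      ((projSimilitudeConj_injective φ).comp Subtype.val_injective) T
      (fun h => hT _ (by rw [← map_pow, h4, map_one]))
    rw [hEnd] at hle
    have hle' := hle.trans (Nat.pow_le_pow_left hTcard _)
    rw [hk] at hle' ⊢
    exact pow_dvd_pow 2 (Nat.lt_two_pow_self.le.trans hle')
  exact ⟨⟨2 ^ ((d * d + 1) ^ 4) ^ ((d * d) ^ 2), by positivity,
    fun H hH => Nat.le_of_dvd (by positivity) (main H hH)⟩, main⟩
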